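/- Let $k$ be a field of characteristic zero, let $i\ge 2$, and put $$Q_i=k[X,Y_1,\dots,Y_i]/(Y_1,\dots,Y_i)^2,\qquad S_i=k[X,Y_1,\dots,Y_i]/\bigl(X^2,(Y_1,\dots,Y_i)^2\bigr)\cong Q_i/(x^2),$$ where $x,y_1,\dots,y_i$ denote the classes of $X,Y_1,\dots,Y_i$ in either ring. A finitely generated $S_i$-module $T$ is *totally reflexive* if $\operatorname{Ext}^j_{S_i}(T,S_i)=0=\operatorname{Ext}^j_{S_i}(\operatorname{Hom}_{S_i}(T,S_i),S_i)$ for all $j>0$ and the biduality map $T\to T^{**}$ is an isomorphism. A *complete resolution* of $T$ is an exact complex $(F_m)_{m\in\mathbb Z}$ of finitely generated free $S_i$-modules whose dual $\operatorname{Hom}_{S_i}(F,S_i)$ is also exact and with $T\cong\operatorname{coker}(F_1\to F_0)$; it is *minimal* if the image of every differential $F_{m+1}\to F_m$ lies in $(x,y_1,\dots,y_i)F_m$. A *matrix factorization* of $x^2$ over $Q_i$ is a pair of $n\times n$ matrices $(\partial,\sigma)$ over $Q_i$ with $\partial\sigma=x^2I_n=\sigma\partial$. Let $T$ be a totally reflexive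 $S_i$-module and let $n$ be its minimal number of generators. 1. There is a matrix factorization $(\partial,\sigma)$ of $x^2$ over $Q_i$, with $n\times n$ matrices, such that $$\cdots\to S_i^n\xrightarrow{\ \overline\partial\ }S_i^n\xrightarrow{\ \overline\sigma\ }S_i^n\xrightarrow{\ \overline\partial\ }S_i^n\to\cdots$$ is a complete resolution of $T\cong\operatorname{coker}\overline\partial$, where bars denote the matrices with entries viewed in $S_i$. Its sequence of differentials is periodic with least period $1$ or $2$. 2. If $T$ has no nonzero projective direct summand, then there are $n\times n$ matrices $B_1,\dots,B_i$ over $k$ such that $T\cong\operatorname{coker}\bigl(xI_n+\sum_{j=1}^iB_jy_j\bigr)$ over $S_i$. 3. For all $n\times n$ matrices $B_1,\dots,B_i$ over $k$ with $T\cong\operatorname{coker}\bigl(xI_n+\sum_{j}B_jy_j\bigr)$ over $S_i$, the pair $\bigl(xI_n+\sum_jB_jy_j,\ xI_n-\sum_jB_jy_j\bigr)$ is a matrix factorization of $x^2$ over $Q_i$, and $$\cdots\to S_i^n\xrightarrow{xI_n+\sum_jB_jy_j}S_i^n\xrightarrow{xI_n-\sum_jB_jy_j}S_i^n\xrightarrow{xI_n+\sum_jB_jy_j}S_i^n\to\cdots$$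 is a minimal complete resolution of $T$ (with $T$ the cokernel of $xI_n+\sum_jB_jy_j$), periodic with least period $1$ or $2$. -/

import Mathlib

universe u v

namespace TotRefl

/-! ### General homological notions over a commutative ring -/

section General

variable (R : Type u) [CommRing R]

/-- A finitely generated `R`-module `M` is totally reflexive if `Ext^j(M, R) = 0` and
`Ext^j(Hom(M, R), R) = 0` for all `j > 0`, and the biduality map `M → M**` is bijective. -/
structure IsTotallyReflexive (M : Type u) [AddCommGroup M] [Module R M] : Prop where
  finite : Module.Finite R M
  ext_eq_zero : ∀ j : ℕ, 0 < j →
    Subsingleton (CategoryTheory.Abelian.Ext (ModuleCat.of R M) (ModuleCat.of R R) j)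
  ext_dual_eq_zero : ∀ j : ℕ, 0 < j →
    Subsingleton
      (CategoryTheory.Abelian.Ext (ModuleCat.of R (Module.Dual R M)) (ModuleCat.of R R) j)
  biduality : Function.Bijective (Module.Dual.eval R M)

/-- `M` has no nonzero projective direct summand. -/
def HasNoProjectiveSummand (M : Type u) [AddCommGroup M] [Module R M] : Prop :=
  ∀ P P' : Submodule R M, IsCompl P P' → Module.Projective R P → P = ⊥

variable {R}

/-- The maps `d m : F (m + 1) → F m`, `m ∈ ℤ`, form a totally acyclic complex of finitely
generated free modules: the complex and its `R`-dual are both exact at every spot. -/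
structure IsTotallyAcyclic {F : ℤ → Type v} [∀ m, AddCommGroup (F m)] [∀ m, Module R (F m)]
    (d : ∀ m : ℤ, F (m + 1) →ₗ[R] F m) : Prop where
  free : ∀ m, Module.Free R (F m)
  finite : ∀ m, Module.Finite R (F m)
  exact : ∀ m, Function.Exact (d (m + 1)) (d m)
  exact_dual : ∀ m, Function.Exact (d m).dualMap (d (m + 1)).dualMap

/-- The maps `d m : F (m + 1) → F m` form a complete resolution of `M`: a totally acyclic complex
of finitely generated free modules in which `M` is the syzygy `coker (F 1 → F 0)`. -/
structure IsCompleteResolution (M : Type u) [AddCommGroup M] [Module R M]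
    {F : ℤ → Type v} [∀ m, AddCommGroup (F m)] [∀ m, Module R (F m)]
    (d : ∀ m : ℤ, F (m + 1) →ₗ[R] F m) : Prop where
  totallyAcyclic : IsTotallyAcyclic d
  syzygy : Nonempty ((F 0 ⧸ LinearMap.range (d 0)) ≃ₗ[R] M)

/-- Minimality of a complex of free modules with respect to the (maximal) ideal `I`:
the image of every differential lies in `I F`. -/
def IsMinimalComplex (I : Ideal R) {F : ℤ → Type v} [∀ m, AddCommGroup (F m)]
    [∀ m, Module R (F m)] (d : ∀ m : ℤ, F (m + 1) →ₗ[R] F m) : Prop :=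
  ∀ m, LinearMap.range (d m) ≤ I • (⊤ : Submodule R (F m))

/-- The sequence `⋯ → Rⁿ --A→ Rⁿ --B→ Rⁿ --A→ Rⁿ → ⋯`, in which the differential from degree
`m + 1` to degree `m` is `A` for even `m` and `B` for odd `m`. -/
noncomputable def alternating {n : ℕ} (A B : Matrix (Fin n) (Fin n) R) (m : ℤ) :
    (Fin n → R) →ₗ[R] (Fin n → R) :=
  if Even m then A.mulVecLin else B.mulVecLin

/-- A sequence of endomorphisms of `Rⁿ` has (least) period `p`. -/
def HasLeastPeriod {n : ℕ} (d : ℤ → ((Fin n → R) →ₗ[R] (Fin n → R))) (p : ℕ) : Prop :=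
  IsLeast {q : ℕ | 0 < q ∧ Function.Periodic d (q : ℤ)} p

/-- `(A, B)` is a matrix factorization of `f`: `A B = f I = B A`. -/
def IsMatrixFactorization {n : ℕ} (f : R) (A B : Matrix (Fin n) (Fin n) R) : Prop :=
  A * B = f • (1 : Matrix (Fin n) (Fin n) R) ∧ B * A = f • (1 : Matrix (Fin n) (Fin n) R)

end General

/-! ### The rings `Q_i` and `S_i` -/

section Rings

variable (k : Type u) [Field k] (i : ℕ)

/-- The polynomial ring `k[X, Y_1, …, Y_i]`; the variable `none` is `X`, `some j` is `Y_j`. -/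
abbrev Poly : Type u := MvPolynomial (Option (Fin i)) k

/-- The ideal `(Y_1, …, Y_i)²`. -/
noncomputable def idealQ : Ideal (Poly k i) :=
  (Ideal.span (Set.range fun j : Fin i => (MvPolynomial.X (some j) : Poly k i))) ^ 2

/-- The ideal `(X², (Y_1, …, Y_i)²)`. -/
noncomputable def idealS : Ideal (Poly k i) :=
  Ideal.span {(MvPolynomial.X none : Poly k i) ^ 2} ⊔ idealQ k i

/-- `Q_i = k[X, Y_1, …, Y_i] / (Y_1, …, Y_i)²`. -/
def RingQ : Type u := Poly k i ⧸ idealQ k i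

noncomputable instance : CommRing (RingQ k i) :=
  inferInstanceAs (CommRing (Poly k i ⧸ idealQ k i))

noncomputable instance : Algebra k (RingQ k i) :=
  inferInstanceAs (Algebra k (Poly k i ⧸ idealQ k i))

/-- `S_i = k[X, Y_1, …, Y_i] / (X², (Y_1, …, Y_i)²)`. -/
def RingS : Type u := Poly k i ⧸ idealS k i

noncomputable instance : CommRing (RingS k i) :=
  inferInstanceAs (CommRing (Poly k i ⧸ idealS k i))

noncomputable instance : Algebra k (RingS k i) :=
  inferInstanceAs (Algebra k (Poly k i ⧸ idealS k i))

/-- The canonical surjection `Q_i → S_i`, whose kernel is generated by `x²`. -/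
noncomputable def QtoS : RingQ k i →+* RingS k i :=
  Ideal.Quotient.factor (show idealQ k i ≤ idealS k i from le_sup_right)

/-- The class of `X` in `Q_i`. -/
noncomputable def xQ : RingQ k i := Ideal.Quotient.mk (idealQ k i) (MvPolynomial.X none)

/-- The class of `Y_j` in `Q_i`. -/
noncomputable def yQ (j : Fin i) : RingQ k i := Ideal.Quotient.mk (idealQ k i) (MvPolynomial.X (some j))

/-- The maximal ideal `(x, y_1, …, y_i)` of `S_i`. -/
noncomputable def maxIdealS : Ideal (RingS k i) :=
  Ideal.span (Set.range fun o : Option (Fin i) =>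
    (Ideal.Quotient.mk (idealS k i) (MvPolynomial.X o) : RingS k i))

variable {k i}

/-- The matrix `x I_n + ∑ B_j y_j` over `Q_i`, for `n × n` matrices `B_j` over `k`. -/
noncomputable def linPlus {n : ℕ} (B : Fin i → Matrix (Fin n) (Fin n) k) :
    Matrix (Fin n) (Fin n) (RingQ k i) :=
  xQ k i • (1 : Matrix (Fin n) (Fin n) (RingQ k i)) +
    ∑ j, yQ k i j • (B j).map (algebraMap k (RingQ k i))

/-- The matrix `x I_n - ∑ B_j y_j` over `Q_i`, for `n × n` matrices `B_j` over `k`. -/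
noncomputable def linMinus {n : ℕ} (B : Fin i → Matrix (Fin n) (Fin n) k) :
    Matrix (Fin n) (Fin n) (RingQ k i) :=
  xQ k i • (1 : Matrix (Fin n) (Fin n) (RingQ k i)) -
    ∑ j, yQ k i j • (B j).map (algebraMap k (RingQ k i))

/-- A matrix over `Q_i` with its entries viewed in `S_i`. -/
noncomputable def overS {n : ℕ} (A : Matrix (Fin n) (Fin n) (RingQ k i)) :
    Matrix (Fin n) (Fin n) (RingS k i) :=
  A.map (QtoS k i)

/-- The cokernel over `S_i` of a square matrix. -/
abbrev Coker {n : ℕ} (A : Matrix (Fin n) (Fin n) (RingS k i)) : Type u :=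
  (Fin n → RingS k i) ⧸ LinearMap.range A.mulVecLin

end Rings

end TotRefl

/-! Let `R = k[y_1, …, y_i]/(y)²`, so that `S_i = R[x]/(x²)`. Of total reflexivity only finite
generation and `Ext²(T, S_i) = 0` are needed.

The main point (`yFree_of_subsingleton_ext_two`) is that this vanishing forces `T` to be free over
`R`. A nontrivial relation `∑ y_j t_j = 0` yields an element `f'` of the second free module of a
presentation, such that every `y_l f'` lies in the second syzygy but `y_1 f'` is not in `(y)` times
that syzygy. A linear map on the syzygy can then send `y_1 f'` to an element with nonzero `x y_2`
coefficient. It extends to the free module because `Ext² = 0`, so this value must be a multiple of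
`y_1`. This is impossible, and having two different `y`'s is where `i ≥ 2` enters.

Now let `T` be free over `R`. If some `x t` lies outside `(y)T`, then `S_i t` is a free summand and
can be split off (`exists_functional_of_xS_smul_notMem`). When no such `t` remains, `xT ⊆ (y)T`, so
in an `R`-basis `x` acts as `-∑ B_j y_j` with `B_j` over `k`, and the module is `coker (xI + ∑ B_j
y_j)` (`exists_equiv_coker`). Hence `T ≅ S_i^r ⊕ coker (xI + ∑ B_j y_j)`.

Since `(y)² = 0`, `xI ± ∑ B_j y_j` is a matrix factorization of `x²`. The free part is absorbed by a
block `(x², 1)`. As `x²` is a nonzerodivisor on `Q_i`, every such factorization gives a totally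
acyclic complex over `S_i`. -/

namespace TotRefl
-- Concrete models and coordinates for `Q_i` and `S_i`.
section RingFacts
open TrivSqZeroExt
variable (k : Type u) [Field k] (i : ℕ)

/-- The trivial extension of `k` by `kⁱ`, a model of `k[Y_1, …, Y_i] / (Y_1, …, Y_i)²`. -/
abbrev YRing : Type u := TrivSqZeroExt k (Fin i → k)

/-- The class of `Y_j` in `YRing`. -/
abbrev yModel (j : Fin i) : YRing k i := inr (Pi.single j 1)

theorem idealQ_le_ker {A : Type*} [Semiring A] [Algebra k A] (f : Poly k i →ₐ[k] A)
    (h : ∀ j l, f (MvPolynomial.X (some j)) * f (MvPolynomial.X (some l)) = 0) :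
    ∀ p ∈ idealQ k i, f p = 0 := by
  intro p hp
  have : idealQ k i ≤ RingHom.ker f := by
    rw [idealQ, pow_two, Ideal.span_mul_span', Ideal.span_le]
    rintro _ ⟨_, ⟨j, rfl⟩, _, ⟨l, rfl⟩, rfl⟩
    simpa [RingHom.mem_ker] using h j l
  exact this hp

/-- The quotient map onto `Q_i`. -/
noncomputable def mkQ : Poly k i →ₐ[k] RingQ k i := Ideal.Quotient.mkₐ k (idealQ k i)

/-- The quotient map onto `S_i`. -/
noncomputable def mkS : Poly k i →ₐ[k] RingS k i := Ideal.Quotient.mkₐ k (idealS k i)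

theorem mkQ_surjective : Function.Surjective (mkQ k i) := Ideal.Quotient.mk_surjective

theorem mkS_surjective : Function.Surjective (mkS k i) := Ideal.Quotient.mk_surjective

theorem mkQ_eq_zero_iff {p : Poly k i} : mkQ k i p = 0 ↔ p ∈ idealQ k i :=
  Ideal.Quotient.eq_zero_iff_mem

theorem mkS_eq_zero_iff {p : Poly k i} : mkS k i p = 0 ↔ p ∈ idealS k i :=
  Ideal.Quotient.eq_zero_iff_mem

theorem QtoS_mkQ (p : Poly k i) : QtoS k i (mkQ k i p) = mkS k i p := rfl

/-- Sends `X` to the variable and `Y_j` to its class in `YRing`. -/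
noncomputable def polyModel : Poly k i →ₐ[k] Polynomial (YRing k i) :=
  MvPolynomial.aeval fun o : Option (Fin i) =>
    o.elim Polynomial.X fun j => Polynomial.C (yModel k i j)

/-- Sends `X` to the dual number `ε` and `Y_j` to its class in `YRing`. -/
noncomputable def dualModel : Poly k i →ₐ[k] TrivSqZeroExt (YRing k i) (YRing k i) :=
  MvPolynomial.aeval fun o : Option (Fin i) => o.elim (inr (1 : YRing k i)) fun j => inl (yModel k i j)

/-- The embedding of `Q_i` into the polynomial ring in one variable over `YRing`. -/
noncomputable def toPolyModel : RingQ k i →ₐ[k] Polynomial (YRing k i) :=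
  Ideal.Quotient.liftₐ (idealQ k i) (polyModel k i)
    (idealQ_le_ker k i _ fun j l => by simp [polyModel, ← Polynomial.C_mul])

/-- The canonical map from `S_i` to the dual numbers over `YRing`. -/
noncomputable def toDualModel : RingS k i →ₐ[k] TrivSqZeroExt (YRing k i) (YRing k i) :=
  Ideal.Quotient.liftₐ (idealS k i) (dualModel k i)
    (by
      intro p hp
      have : idealS k i ≤ RingHom.ker (dualModel k i) := by
        refine sup_le ?_ fun q hq => idealQ_le_ker k i (dualModel k i) (fun j l => ?_) q hq
        · rw [Ideal.span_singleton_le_iff_mem]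
          simp [RingHom.mem_ker, pow_two, dualModel]
        · simp [dualModel, ← inl_mul]
      exact this hp)

theorem toPolyModel_mkQ (p : Poly k i) : toPolyModel k i (mkQ k i p) = polyModel k i p := rfl

theorem toDualModel_mkS (p : Poly k i) : toDualModel k i (mkS k i p) = dualModel k i p := rfl

/-- The class of `X` in `S_i`. -/
noncomputable def xS : RingS k i := mkS k i (MvPolynomial.X none)

/-- The class of `Y_j` in `S_i`. -/
noncomputable def yS (j : Fin i) : RingS k i := mkS k i (MvPolynomial.X (some j))

theorem mkQ_X_none : mkQ k i (MvPolynomial.X none) = xQ k i := rfl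

theorem mkQ_X_some (j : Fin i) : mkQ k i (MvPolynomial.X (some j)) = yQ k i j := rfl

@[simp] theorem toPolyModel_xQ : toPolyModel k i (xQ k i) = Polynomial.X := by
  rw [← mkQ_X_none, toPolyModel_mkQ]
  simp [polyModel]

@[simp] theorem toPolyModel_yQ (j : Fin i) :
    toPolyModel k i (yQ k i j) = Polynomial.C (yModel k i j) := by
  rw [← mkQ_X_some, toPolyModel_mkQ]
  simp [polyModel]

@[simp] theorem toDualModel_xS : toDualModel k i (xS k i) = inr 1 := by
  rw [xS, toDualModel_mkS]
  simp [dualModel]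

@[simp] theorem toDualModel_yS (j : Fin i) :
    toDualModel k i (yS k i j) = inl (yModel k i j) := by
  rw [yS, toDualModel_mkS]
  simp [dualModel]

theorem yQ_mul_yQ (j l : Fin i) : yQ k i j * yQ k i l = 0 := by
  rw [← mkQ_X_some, ← mkQ_X_some, ← map_mul, mkQ_eq_zero_iff, idealQ, pow_two]
  exact Ideal.mul_mem_mul (Ideal.subset_span ⟨j, rfl⟩) (Ideal.subset_span ⟨l, rfl⟩)

theorem QtoS_surjective : Function.Surjective (QtoS k i) :=
  Ideal.Quotient.factor_surjective _

@[simp] theorem QtoS_xQ : QtoS k i (xQ k i) = xS k i := rfl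

@[simp] theorem QtoS_yQ (j : Fin i) : QtoS k i (yQ k i j) = yS k i j := rfl

@[simp] theorem QtoS_algebraMap (c : k) :
    QtoS k i (algebraMap k (RingQ k i) c) = algebraMap k (RingS k i) c := rfl

theorem QtoS_eq_zero_iff (q : RingQ k i) : QtoS k i q = 0 ↔ xQ k i ^ 2 ∣ q := by
  constructor
  · obtain ⟨p, rfl⟩ := mkQ_surjective k i q
    intro hp
    rw [QtoS_mkQ, mkS_eq_zero_iff, idealS, Submodule.mem_sup] at hp
    obtain ⟨a, ha, b, hb, rfl⟩ := hp
    obtain ⟨c, rfl⟩ := Ideal.mem_span_singleton'.1 ha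
    refine ⟨mkQ k i c, ?_⟩
    rw [map_add, (mkQ_eq_zero_iff k i).2 hb, add_zero, map_mul, mul_comm, map_pow, mkQ_X_none]
  · rintro ⟨c, rfl⟩
    have : QtoS k i (xQ k i ^ 2) = 0 := by
      rw [← mkQ_X_none, ← map_pow, QtoS_mkQ, mkS_eq_zero_iff]
      exact Ideal.mem_sup_left (Ideal.subset_span rfl)
    rw [map_mul, this, zero_mul]

theorem xS_sq : xS k i ^ 2 = 0 := by
  rw [← QtoS_xQ, ← map_pow, QtoS_eq_zero_iff]

theorem xS_mul_xS : xS k i * xS k i = 0 := by rw [← pow_two, xS_sq]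

theorem yS_mul_yS (j l : Fin i) : yS k i j * yS k i l = 0 := by
  rw [← QtoS_yQ, ← QtoS_yQ, ← map_mul, yQ_mul_yQ, map_zero]

/-- Sending the variable to `x` and the `j`-th basis vector to `y_j` defines a left inverse `ψ`, as
can be checked on generators. -/
theorem toPolyModel_injective : Function.Injective (toPolyModel k i) := by
  let g : (Fin i → k) →ₗ[k] RingQ k i := Fintype.linearCombination k (yQ k i)
  have hg : ∀ a b, g a * g b = 0 := fun a b => by
    simp [g, Fintype.linearCombination_apply, Finset.sum_mul_sum, yQ_mul_yQ]
  let L : YRing k i →ₐ[k] RingQ k i := TrivSqZeroExt.lift (Algebra.ofId k _) g hg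
    (fun r a => by rw [map_smul, Algebra.ofId_apply, Algebra.smul_def])
    (fun r a => by rw [op_smul_eq_smul, map_smul, Algebra.ofId_apply, Algebra.smul_def, mul_comm])
  let ψ : Polynomial (YRing k i) →ₐ[k] RingQ k i := Polynomial.eval₂AlgHom L (xQ k i)
    fun _ => Commute.all _ _
  refine Function.LeftInverse.injective (g := ψ) fun q => ?_
  obtain ⟨p, rfl⟩ := mkQ_surjective k i q
  have : (ψ.comp (toPolyModel k i)).comp (mkQ k i) = mkQ k i := by
    refine MvPolynomial.algHom_ext fun o => ?_
    cases o with
    | none => simp [mkQ_X_none, ψ]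
    | some j => simp [mkQ_X_some, ψ, L, g, Fintype.linearCombination_apply_single]
  exact AlgHom.congr_fun this p

theorem xQ_sq_mul_cancel {q : RingQ k i} (h : xQ k i ^ 2 * q = 0) : q = 0 := by
  apply toPolyModel_injective k i
  have := congrArg (toPolyModel k i) h
  rw [map_mul, map_pow, toPolyModel_xQ, map_zero, Polynomial.X_pow_mul] at this
  rw [map_zero]
  ext1 m
  simpa using congrArg (fun p => Polynomial.coeff p (m + 2)) this

/-- The augmentation of `S_i`. -/
noncomputable def augS : RingS k i →+* k :=
  (fstHom k k (Fin i → k)).toRingHom.comp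
    ((fstHom k (YRing k i) (YRing k i)).toRingHom.comp (toDualModel k i).toRingHom)

variable {k i}

theorem augS_apply (s : RingS k i) : augS k i s = (toDualModel k i s).fst.fst := rfl

@[simp] theorem augS_xS : augS k i (xS k i) = 0 := by simp [augS_apply]

@[simp] theorem augS_yS (j : Fin i) : augS k i (yS k i j) = 0 := by simp [augS_apply]

@[simp] theorem augS_algebraMap (c : k) : augS k i (algebraMap k _ c) = c := by
  simp [augS_apply, algebraMap_eq_inl']

instance : Nontrivial (RingS k i) := (augS k i).domain_nontrivial

/-- Coordinates modulo `(y)`, where `S_i` becomes `k[x]/(x²)`. The `c j` are left in `S_i`; a second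
application makes them explicit. -/
theorem exists_coordinates (s : RingS k i) : ∃ (a b : k) (c : Fin i → RingS k i),
    s = algebraMap k _ a + xS k i * algebraMap k _ b + ∑ j, yS k i j * c j := by
  obtain ⟨p, rfl⟩ := mkS_surjective k i s
  induction p using MvPolynomial.induction_on with
  | C a =>
    refine ⟨a, 0, 0, ?_⟩
    rw [← MvPolynomial.algebraMap_eq, AlgHom.commutes]
    simp
  | add p q hp hq =>
    obtain ⟨a, b, c, h⟩ := hp
    obtain ⟨a', b', c', h'⟩ := hq
    refine ⟨a + a', b + b', c + c', ?_⟩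
    rw [map_add, h, h']
    simp only [map_add, Pi.add_apply, mul_add, Finset.sum_add_distrib]
    ring
  | mul_X p o hp =>
    obtain ⟨a, b, c, h⟩ := hp
    rw [map_mul]
    cases o with
    | none =>
      refine ⟨0, a, fun j => c j * xS k i, ?_⟩
      rw [h, ← xS]
      simp only [add_mul, Finset.sum_mul, mul_assoc, map_zero, zero_add]
      linear_combination (algebraMap k _ b) * xS_mul_xS k i
    | some j =>
      refine ⟨0, 0, Pi.single j (mkS k i p), ?_⟩
      simp only [map_zero, mul_zero, zero_add]
      rw [Finset.sum_eq_single j (by intro l _ hl; rw [Pi.single_eq_of_ne hl, mul_zero]) (by simp),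
        Pi.single_eq_same, mul_comm, yS]

theorem exists_coordinates_full (s : RingS k i) : ∃ (a b : k) (c d : Fin i → k),
    s = algebraMap k _ a + xS k i * algebraMap k _ b +
      ∑ j, yS k i j * (algebraMap k _ (c j) + xS k i * algebraMap k _ (d j)) := by
  obtain ⟨a, b, c, rfl⟩ := exists_coordinates s
  choose a' b' c' h using fun j => exists_coordinates (c j)
  refine ⟨a, b, a', b', ?_⟩
  congr 1
  refine Finset.sum_congr rfl fun j _ => ?_
  rw [h j, mul_add _ _ (∑ l, _), Finset.mul_sum]
  simp [← mul_assoc, yS_mul_yS]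

instance : Module.Finite k (RingS k i) := by
  let v : (Fin 2 ⊕ (Fin i ⊕ Fin i)) → RingS k i :=
    Sum.elim ![1, xS k i] (Sum.elim (yS k i) fun j => yS k i j * xS k i)
  refine ⟨(Submodule.eq_top_iff'.2 fun s => ?_ : Submodule.span k (Set.range v) = ⊤) ▸
    Submodule.fg_span (Set.finite_range v)⟩
  have hv : ∀ o (c : k), v o * algebraMap k _ c ∈ Submodule.span k (Set.range v) := fun o c => by
    rw [mul_comm, ← Algebra.smul_def]
    exact Submodule.smul_mem _ _ (Submodule.subset_span ⟨o, rfl⟩)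
  obtain ⟨a, b, c, d, rfl⟩ := exists_coordinates_full s
  refine add_mem (add_mem ?_ (hv (.inl 1) b)) (sum_mem fun j _ => ?_)
  · simpa [v] using hv (.inl 0) a
  · rw [mul_add, ← mul_assoc]
    exact add_mem (hv (.inr (.inl j)) _) (hv (.inr (.inr j)) _)

instance : IsNoetherianRing (RingS k i) :=
  inferInstanceAs (IsNoetherianRing (Poly k i ⧸ idealS k i))

end RingFacts

/-! ### Vanishing of `Ext²` as an extension property. -/

section Extension
open CategoryTheory Abelian

/-- Dimension shifting: `Ext²(T, N) = 0` gives `Ext¹(ker p, N) = 0` since `F` is projective, and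
then the long exact sequence of `0 → ker q → F' → ker p → 0` makes restriction to `ker q`
surjective. -/
theorem exists_extend_of_subsingleton_ext_two {R : Type u} [CommRing R] {T F F' N : Type u}
    [AddCommGroup T] [Module R T] [AddCommGroup F] [Module R F] [AddCommGroup F'] [Module R F']
    [AddCommGroup N] [Module R N] [Module.Projective R F] [Module.Projective R F']
    (hE : Subsingleton (Ext (ModuleCat.of R T) (ModuleCat.of R N) 2))
    (p : F →ₗ[R] T) (hp : Function.Surjective p)
    (q : F' →ₗ[R] LinearMap.ker p) (hq : Function.Surjective q)
    (g : LinearMap.ker q →ₗ[R] N) :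
    ∃ h : F' →ₗ[R] N, ∀ v : LinearMap.ker q, h v = g v := by
  have hS := LinearMap.shortExact_shortComplexKer hp
  have hS' := LinearMap.shortExact_shortComplexKer hq
  have : Projective p.shortComplexKer.X₂ :=
    inferInstanceAs (Projective (ModuleCat.of R F))
  have hδ : ∀ α : Ext (ModuleCat.of R (LinearMap.ker p)) (ModuleCat.of R N) 1, α = 0 := by
    intro α
    obtain ⟨β, rfl⟩ := Ext.contravariant_sequence_exact₁ hS _ α (n₁ := 2) rfl
      (Subsingleton.elim (h := hE) _ _)
    rw [Ext.eq_zero_of_projective β, Ext.comp_zero]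
  obtain ⟨β, hβ⟩ := Ext.contravariant_sequence_exact₁ hS' _ (Ext.mk₀ (ModuleCat.ofHom g)) (n₁ := 1) rfl
    (hδ _)
  obtain ⟨f, rfl⟩ := (Ext.mk₀_bijective _ _).2 β
  rw [Ext.mk₀_comp_mk₀] at hβ
  have := (Ext.mk₀_bijective _ _).1 hβ
  refine ⟨f.hom, fun v => ?_⟩
  exact congrArg (fun h => h.hom v) this

end Extension

/-! ### Freeness over `k[y_1, …, y_i]/(y)²`. -/

section YFree
variable (k : Type u) [Field k] (i : ℕ)
variable (M : Type*) [AddCommGroup M] [Module (RingS k i) M]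

/-- The map `(m_j) ↦ ∑ y_j m_j`, with image `(y_1, …, y_i) M`. -/
noncomputable def ySum : (Fin i → M) →ₗ[RingS k i] M :=
  ∑ j, yS k i j • LinearMap.proj j

variable {M}

theorem ySum_apply (m : Fin i → M) : ySum k i M m = ∑ j, yS k i j • m j := by
  simp [ySum]

theorem ySum_single (j : Fin i) (m : M) : ySum k i M (Pi.single j m) = yS k i j • m := by
  rw [ySum_apply, Finset.sum_eq_single j]
  · simp
  · intro l _ hl
    simp [hl]
  · simp

theorem yS_smul_ySum (j : Fin i) (m : Fin i → M) : yS k i j • ySum k i M m = 0 := by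
  simp [ySum_apply, Finset.smul_sum, ← mul_smul, yS_mul_yS]

theorem yS_smul_mem (j : Fin i) (m : M) : yS k i j • m ∈ LinearMap.range (ySum k i M) :=
  ⟨_, ySum_single k i j m⟩

theorem ySum_eq_zero {m : Fin i → M} (h : ∀ j, m j ∈ LinearMap.range (ySum k i M)) :
    ySum k i M m = 0 := by
  rw [ySum_apply]
  refine Finset.sum_eq_zero fun j _ => ?_
  obtain ⟨w, hw⟩ := h j
  rw [← hw, yS_smul_ySum]

theorem map_ySum {N : Type*} [AddCommGroup N] [Module (RingS k i) N] (f : M →ₗ[RingS k i] N)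
    (m : Fin i → M) : f (ySum k i M m) = ySum k i N (fun j => f (m j)) := by
  simp [ySum_apply]

variable (M) in
/-- The only relations `∑ y_j m_j = 0` in `M` are those with all `m_j ∈ (y_1, …, y_i) M`; this
says that `M` is free over the subring `k[y_1, …, y_i]`. -/
def YFree : Prop :=
  ∀ m : Fin i → M, ySum k i M m = 0 → ∀ j, m j ∈ LinearMap.range (ySum k i M)

variable {k i}

theorem YFree.of_retract {N : Type*} [AddCommGroup N] [Module (RingS k i) N] (h : YFree k i M)
    (f : N →ₗ[RingS k i] M) (g : M →ₗ[RingS k i] N) (hgf : ∀ n, g (f n) = n) : YFree k i N := by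
  intro m hm j
  obtain ⟨w, hw⟩ := h (fun l => f (m l)) (by rw [← map_ySum, hm, map_zero]) j
  refine ⟨fun l => g (w l), ?_⟩
  rw [← map_ySum, hw, hgf]

theorem coordinates_unique {a b : k} {c d : Fin i → k}
    (h : algebraMap k (RingS k i) a + xS k i * algebraMap k _ b +
      ∑ j, yS k i j * (algebraMap k _ (c j) + xS k i * algebraMap k _ (d j)) = 0) :
    a = 0 ∧ b = 0 ∧ c = 0 ∧ d = 0 := by
  have key := congrArg (toDualModel k i) h
  simp only [map_add, map_mul, map_sum, AlgHom.commutes, toDualModel_xS, toDualModel_yS,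
    map_zero] at key
  refine ⟨?_, ?_, ?_, ?_⟩
  · simpa [TrivSqZeroExt.algebraMap_eq_inl', TrivSqZeroExt.fst_sum] using
      congrArg (fun z => z.fst.fst) key
  · simpa [TrivSqZeroExt.algebraMap_eq_inl', TrivSqZeroExt.fst_sum, TrivSqZeroExt.snd_sum] using
      congrArg (fun z => z.snd.fst) key
  · funext l
    simpa [TrivSqZeroExt.algebraMap_eq_inl', TrivSqZeroExt.fst_sum, TrivSqZeroExt.snd_sum,
      Pi.single_apply] using congrArg (fun z => z.fst.snd l) key
  · funext l
    simpa [TrivSqZeroExt.algebraMap_eq_inl', TrivSqZeroExt.fst_sum, TrivSqZeroExt.snd_sum,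
      Pi.single_apply] using congrArg (fun z => z.snd.snd l) key

/-- In `∑ y_j m_j` only the coordinates of `m_j` at `1` and `x` survive, and they become the
coordinates at `y_j` and `x y_j`; by uniqueness they vanish. -/
theorem yFree_self : YFree k i (RingS k i) := by
  intro m hm j
  choose a b c h using fun j => exists_coordinates (m j)
  have h' : ∀ j, m j = algebraMap k _ (a j) + xS k i * algebraMap k _ (b j) + ySum k i _ (c j) :=
    fun j => by rw [h, ySum_apply]; rfl
  have := coordinates_unique (k := k) (i := i) (a := 0) (b := 0) (c := a) (d := b) (by
    rw [← hm, ySum_apply]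
    simp only [map_zero, mul_zero, zero_add]
    refine Finset.sum_congr rfl fun j _ => ?_
    rw [smul_eq_mul, h' j, mul_add _ _ (ySum _ _ _ _), ← smul_eq_mul _ (ySum _ _ _ _),
      yS_smul_ySum, add_zero])
  rw [h' j, this.2.2.1, this.2.2.2]
  simp

theorem YFree.pi {ι : Type*} (h : YFree k i M) : YFree k i (ι → M) := by
  intro m hm j
  have := fun a => h (fun l => m l a) (by
    simpa [ySum_apply] using congrFun hm a) j
  choose w hw using this
  refine ⟨fun l a => w a l, ?_⟩
  funext a
  rw [← hw a]
  simp [ySum_apply]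

theorem smul_map_of_generators {N : Type*} [AddCommGroup N] [Module (RingS k i) N]
    (f : M →+ N)
    (hk : ∀ (c : k) m, f (algebraMap k (RingS k i) c • m) = algebraMap k (RingS k i) c • f m)
    (hx : ∀ m, f (xS k i • m) = xS k i • f m) (hy : ∀ j m, f (yS k i j • m) = yS k i j • f m)
    (s : RingS k i) (m : M) : f (s • m) = s • f m := by
  obtain ⟨p, rfl⟩ := mkS_surjective k i s
  induction p using MvPolynomial.induction_on generalizing m with
  | C a =>
    rw [← MvPolynomial.algebraMap_eq, AlgHom.commutes, hk]
  | add p q hp hq => rw [map_add, add_smul, map_add, hp, hq, add_smul]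
  | mul_X p o hp =>
    rw [map_mul, mul_smul, hp, mul_smul]
    cases o with
    | none => rw [← xS, hx]
    | some j => rw [← yS, hy]

/-- A `k[y_1, …, y_i]`-linear map `g : M → S_i` induces the `S_i`-linear map
`m ↦ g (x m) + x g(m)`. -/
noncomputable def twistedExtend [Module k M] [IsScalarTower k (RingS k i) M]
    (g : M →ₗ[k] RingS k i) (hg : ∀ j m, g (yS k i j • m) = yS k i j • g m) :
    M →ₗ[RingS k i] RingS k i where
  toFun m := g (xS k i • m) + xS k i * g m
  map_add' m m' := by simp only [smul_add, map_add, mul_add]; ring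
  map_smul' := smul_map_of_generators
    { toFun := fun m => g (xS k i • m) + xS k i * g m
      map_zero' := by simp
      map_add' := fun m m' => by simp only [smul_add, map_add, mul_add]; ring }
    (fun c m => by
      simp only [AddMonoidHom.coe_mk, ZeroHom.coe_mk, algebraMap_smul, smul_comm (xS k i) c m,
        map_smul, mul_smul_comm, smul_add])
    -- Because `x² = 0`, both sides reduce to `x g(x m)`.
    (fun m => by
      simp [← mul_smul, xS_mul_xS, mul_add, ← mul_assoc])
    (fun j m => by
      simp only [AddMonoidHom.coe_mk, ZeroHom.coe_mk, smul_comm (xS k i) (yS k i j) m, hg,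
        smul_eq_mul]
      ring)

theorem twistedExtend_apply [Module k M] [IsScalarTower k (RingS k i) M]
    (g : M →ₗ[k] RingS k i) (hg : ∀ j m, g (yS k i j • m) = yS k i j • g m) (m : M) :
    twistedExtend g hg m = g (xS k i • m) + xS k i * g m := rfl

/-- A module with `Ext²(T, S_i) = 0` is free over `k[y_1, …, y_i]`. -/
theorem yFree_of_subsingleton_ext_two (hi : 2 ≤ i) {T : Type u} [AddCommGroup T]
    [Module (RingS k i) T] [Module.Finite (RingS k i) T]
    (hE : Subsingleton (CategoryTheory.Abelian.Ext (ModuleCat.of (RingS k i) T)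
      (ModuleCat.of (RingS k i) (RingS k i)) 2)) : YFree k i T := by
  obtain ⟨n, p, hp⟩ := Module.Finite.exists_fin' (RingS k i) T
  obtain ⟨n', q, hq⟩ := Module.Finite.exists_fin' (RingS k i) (LinearMap.ker p)
  intro t ht j
  by_contra hj
  choose f hf using fun l => hp (t l)
  have he : p (ySum k i _ f) = 0 := by rw [map_ySum]; simpa [hf] using ht
  obtain ⟨f', hf'⟩ := hq ⟨_, he⟩
  have hker : ∀ l, q (yS k i l • f') = 0 := fun l => by
    rw [map_smul, hf']
    ext1
    exact yS_smul_ySum k i l f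
  let y₁ : Fin i := ⟨0, by omega⟩
  let y₂ : Fin i := ⟨1, by omega⟩
  have hy : y₁ ≠ y₂ := by simp [y₁, y₂]
  let v₁ : LinearMap.ker q := ⟨yS k i y₁ • f', hker y₁⟩
  -- If `y_1 f' = ∑ y_l w_l` with `w_l ∈ ker q`, freeness of `F'` puts `f' - w_1` in `(y)F'`, so `q
  -- f' = ∑ y_j f_j` lies in `(y) ker p`. Freeness of `F` then gives `f_j ∈ ker p + (y)F`, that is,
  -- `t_j ∈ (y)T`.
  have hv : v₁ ∉ LinearMap.range (ySum k i (LinearMap.ker q)) := by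
    rintro ⟨w, hw⟩
    have hw' : ySum k i _ (fun l => (w l : Fin n' → RingS k i)) = yS k i y₁ • f' := by
      have := congrArg Subtype.val hw
      exact (map_ySum k i (LinearMap.ker q).subtype w).symm.trans this
    obtain ⟨r, hr⟩ := (yFree_self (k := k) (i := i)).pi (Pi.single y₁ f' - fun l => (w l : Fin n' → RingS k i))
      (by rw [map_sub, ySum_single, hw', sub_self]) y₁
    have hq' := congrArg q hr
    rw [map_ySum, Pi.sub_apply, map_sub, Pi.single_eq_same, hf', (w y₁).2, sub_zero] at hq'
    have hp' := congrArg Subtype.val hq'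
    rw [← Submodule.subtype_apply, map_ySum] at hp'
    obtain ⟨r', hr'⟩ := (yFree_self (k := k) (i := i)).pi (f - fun l => (q (r l) : Fin n → RingS k i))
      (by rw [map_sub, sub_eq_zero]; exact hp'.symm) j
    refine hj ⟨fun l => p (r' l), ?_⟩
    rw [← map_ySum, hr', Pi.sub_apply, map_sub, hf, (q (r j)).2, sub_zero]
  obtain ⟨μ, hμ1, hμ0⟩ := Submodule.exists_dual_map_eq_bot_of_notMem (R := k)
    (p := (LinearMap.range (ySum k i (LinearMap.ker q))).restrictScalars k) hv inferInstance
  have hμ : ∀ l v, μ (yS k i l • v) = 0 := fun l v => by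
    have : μ (yS k i l • v) ∈ Submodule.map μ
      ((LinearMap.range (ySum k i (LinearMap.ker q))).restrictScalars k) :=
      ⟨_, yS_smul_mem k i l v, rfl⟩
    rwa [hμ0] at this
  -- Values in `k y_2` make `g` linear over the `y`'s: `μ` kills `(y) ker q` and `y_l y_2 = 0`.
  let g : LinearMap.ker q →ₗ[k] RingS k i :=
    (LinearMap.toSpanSingleton k (RingS k i) (yS k i y₂)).comp μ
  have hg : ∀ v, g v = algebraMap k _ (μ v) * yS k i y₂ := fun v => by
    simp [g, Algebra.smul_def]
  obtain ⟨h, hh⟩ := exists_extend_of_subsingleton_ext_two hE p hp q hq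
    (twistedExtend g fun l v => by rw [hg, hg, hμ, smul_eq_mul, mul_left_comm, yS_mul_yS]; simp)
  have key := hh v₁
  rw [twistedExtend_apply, hg, hg] at key
  change h (yS k i y₁ • f') = _ at key
  rw [map_smul] at key
  -- Compare coefficients of `x y_2`: zero for `y_1 h(f')`, and `μ v₁` for the twisted extension of
  -- `g`.
  have key' := congrArg (fun z => (toDualModel k i z).snd.snd y₂) key
  simp [hy.symm, TrivSqZeroExt.algebraMap_eq_inl'] at key'
  exact hμ1 key'.symm

end YFree

/-! ### Splitting off free summands and presenting the remainder. -/

section Structure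
variable {k : Type u} [Field k] {i : ℕ}

theorem isUnit_of_augS_ne_zero {s : RingS k i} (h : augS k i s ≠ 0) : IsUnit s := by
  obtain ⟨a, b, c, rfl⟩ := exists_coordinates s
  have ha : a ≠ 0 := by simpa using h
  rw [add_assoc]
  refine IsNilpotent.isUnit_add_left_of_commute ?_ (IsUnit.map _ ha.isUnit) (Commute.all _ _)
  refine Commute.isNilpotent_add (Commute.all _ _) ⟨2, ?_⟩ ?_
  · rw [mul_pow, xS_sq, zero_mul]
  · exact isNilpotent_sum fun j _ => ⟨2, by rw [mul_pow, pow_two, yS_mul_yS, zero_mul]⟩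

section Section
variable {M : Type*} [AddCommGroup M] [Module (RingS k i) M] [Module k M]
  [IsScalarTower k (RingS k i) M]

variable (k i M) in
/-- The `k`-subspace `(y_1, …, y_i) M`. -/
noncomputable abbrev yIm : Submodule k M := (LinearMap.range (ySum k i M)).restrictScalars k

variable (k i M) in
theorem exists_section : ∃ σ : (M ⧸ yIm k i M) →ₗ[k] M, ∀ u, (yIm k i M).mkQ (σ u) = u := by
  obtain ⟨σ, hσ⟩ := LinearMap.exists_rightInverse_of_surjective (yIm k i M).mkQ
    (LinearMap.range_eq_top.2 (Submodule.mkQ_surjective _))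
  exact ⟨σ, fun u => LinearMap.congr_fun hσ u⟩

theorem mkQ_eq_zero {m : M} : (yIm k i M).mkQ m = 0 ↔ m ∈ LinearMap.range (ySum k i M) :=
  Submodule.Quotient.mk_eq_zero _

/-- The sum of a `k`-linear section of `M → M / (y) M` and its multiples by the `y_j`. -/
noncomputable def sectionSum (σ : (M ⧸ yIm k i M) →ₗ[k] M) :
    ((M ⧸ yIm k i M) × (Fin i → M ⧸ yIm k i M)) →ₗ[k] M :=
  σ.coprod (((ySum k i M).restrictScalars k).comp (σ.compLeft (Fin i)))

theorem sectionSum_apply (σ : (M ⧸ yIm k i M) →ₗ[k] M) (u : M ⧸ yIm k i M)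
    (w : Fin i → M ⧸ yIm k i M) :
    sectionSum σ (u, w) = σ u + ySum k i M (fun j => σ (w j)) := rfl

variable {σ : (M ⧸ yIm k i M) →ₗ[k] M}

theorem sub_section_mem (hσ : ∀ u, (yIm k i M).mkQ (σ u) = u) (m : M) :
    m - σ ((yIm k i M).mkQ m) ∈ LinearMap.range (ySum k i M) := by
  rw [← mkQ_eq_zero, map_sub, hσ, sub_self]

theorem ySum_section (hσ : ∀ u, (yIm k i M).mkQ (σ u) = u) (m : Fin i → M) :
    ySum k i M (fun j => σ ((yIm k i M).mkQ (m j))) = ySum k i M m := by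
  refine (sub_eq_zero.1 ?_).symm
  rw [← map_sub]
  exact ySum_eq_zero k i fun j => sub_section_mem hσ (m j)

/-- This makes `M` the free module over `k[y]/(y)²` on `σ` of a `k`-basis of `M / (y)M`. -/
theorem sectionSum_bijective (hσ : ∀ u, (yIm k i M).mkQ (σ u) = u) (hM : YFree k i M) :
    Function.Bijective (sectionSum σ) := by
  constructor
  · rw [← LinearMap.ker_eq_bot, LinearMap.ker_eq_bot']
    rintro ⟨u, w⟩ h
    rw [sectionSum_apply] at h
    have hu : u = 0 := by
      rw [← hσ u, mkQ_eq_zero, eq_neg_of_add_eq_zero_left h]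
      exact neg_mem ⟨_, rfl⟩
    rw [hu, map_zero, zero_add] at h
    refine Prod.ext hu (funext fun j => ?_)
    change w j = 0
    rw [← hσ (w j), mkQ_eq_zero]
    exact hM _ h j
  · intro m
    obtain ⟨w, hw⟩ := sub_section_mem hσ m
    refine ⟨((yIm k i M).mkQ m, fun j => (yIm k i M).mkQ (w j)), ?_⟩
    rw [sectionSum_apply, ySum_section hσ, hw, add_sub_cancel]

/-- If `x t ∉ (y) M` then `S_i t` is a free direct summand of `M`. -/
theorem exists_functional_of_xS_smul_notMem (hM : YFree k i M) {t : M}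
    (ht : xS k i • t ∉ LinearMap.range (ySum k i M)) :
    ∃ φ : M →ₗ[RingS k i] RingS k i, φ t = 1 := by
  obtain ⟨σ, hσ⟩ := exists_section k i M
  let e := LinearEquiv.ofBijective _ (sectionSum_bijective hσ hM)
  have he : ∀ u w, e (u, w) = σ u + ySum k i M (fun j => σ (w j)) := fun _ _ => rfl
  obtain ⟨f, hf⟩ := not_forall.1
    ((Module.forall_dual_apply_eq_zero_iff k ((yIm k i M).mkQ (xS k i • t))).not.2
      (mkQ_eq_zero.not.2 ht))
  let a : k →ₗ[k] RingS k i := Algebra.linearMap k (RingS k i)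
  -- The extension of the functional `f` on `M / (y)M` that is linear over the `y`'s, written in the
  -- decomposition given by `sectionSum`.
  let g' : ((M ⧸ yIm k i M) × (Fin i → M ⧸ yIm k i M)) →ₗ[k] RingS k i :=
    (a.comp f).coprod (((ySum k i (RingS k i)).restrictScalars k).comp ((a.comp f).compLeft (Fin i)))
  have hg' : ∀ u w, g' (u, w) = algebraMap k _ (f u) +
    ySum k i (RingS k i) (fun j => algebraMap k _ (f (w j))) := fun _ _ => rfl
  let g : M →ₗ[k] RingS k i := g'.comp e.symm.toLinearMap
  have hg : ∀ u w, g (e (u, w)) = algebraMap k _ (f u) +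
    ySum k i (RingS k i) (fun j => algebraMap k _ (f (w j))) := fun u w => by
      simp only [g, LinearMap.comp_apply, LinearEquiv.coe_coe, LinearEquiv.symm_apply_apply, hg']
  have hgy : ∀ j m, g (yS k i j • m) = yS k i j • g m := by
    intro j m
    obtain ⟨⟨u, w⟩, rfl⟩ := e.surjective m
    have : yS k i j • e (u, w) = e (0, Pi.single j u) := by
      rw [he, he, smul_add, yS_smul_ySum, add_zero, map_zero, zero_add, ← ySum_single]
      congr 1
      funext l
      rcases eq_or_ne l j with rfl | h <;> simp [*]
    rw [this, hg, hg, smul_add, yS_smul_ySum, add_zero, map_zero, map_zero, zero_add, ← ySum_single]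
    congr 1
    funext l
    rcases eq_or_ne l j with rfl | h <;> simp [*]
  have haug : ∀ m, augS k i (g m) = f ((yIm k i M).mkQ m) := by
    intro m
    obtain ⟨⟨u, w⟩, rfl⟩ := e.surjective m
    rw [hg, he, map_add, map_add, hσ, mkQ_eq_zero.2 ⟨_, rfl⟩, add_zero, augS_algebraMap, ySum_apply]
    simp
  -- Modulo the maximal ideal, `g(x t) + x g(t)` is `f` of the class of `x t`, nonzero by the choice
  -- of `f`.
  have hu : IsUnit (twistedExtend g hgy t) := by
    refine isUnit_of_augS_ne_zero ?_
    rw [twistedExtend_apply, map_add, map_mul, augS_xS, zero_mul, add_zero, haug]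
    exact hf
  obtain ⟨u, hu⟩ := hu
  refine ⟨(↑u⁻¹ : RingS k i) • twistedExtend g hgy, ?_⟩
  rw [LinearMap.smul_apply, ← hu, smul_eq_mul, Units.inv_mul]

end Section

theorem exists_prod_equiv_of_functional {R M : Type*} [CommRing R] [AddCommGroup M] [Module R M]
    {t : M} (φ : M →ₗ[R] R) (h : φ t = 1) : ∃ e : (R × LinearMap.ker φ) ≃ₗ[R] M, ∀ s m, e (s, m) = s • t + m := by
  refine ⟨LinearEquiv.ofBijective
    ((LinearMap.toSpanSingleton R M t).coprod (LinearMap.ker φ).subtype) ⟨?_, fun m => ?_⟩,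
    fun _ _ => rfl⟩
  · rw [← LinearMap.ker_eq_bot, LinearMap.ker_eq_bot']
    rintro ⟨s, n⟩ hs
    have hs' : s • t + n = 0 := hs
    have : s = 0 := by simpa [h] using congrArg φ hs'
    subst this
    simpa using hs'
  · refine ⟨(φ m, ⟨m - φ m • t, by simp [h]⟩), ?_⟩
    simp

/-- Constant vectors in `S_iⁿ`. -/
noncomputable def constVec (n : ℕ) : (Fin n → k) →ₗ[k] (Fin n → RingS k i) :=
  (Algebra.linearMap k (RingS k i)).compLeft (Fin n)

theorem overS_linPlus_mulVec {n : ℕ} (B : Fin i → Matrix (Fin n) (Fin n) k)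
    (v : Fin n → RingS k i) : (overS (linPlus B)).mulVec v =
      xS k i • v + ySum k i _ fun j => ((B j).map (algebraMap k (RingS k i))).mulVec v := by
  have : overS (linPlus B) = xS k i • (1 : Matrix (Fin n) (Fin n) (RingS k i)) +
      ∑ j, yS k i j • (B j).map (algebraMap k (RingS k i)) := by
    ext a b
    simp [overS, linPlus, Matrix.sum_apply, Matrix.one_apply, apply_ite]
  rw [this, Matrix.add_mulVec, Matrix.smul_mulVec, Matrix.one_mulVec, Matrix.sum_mulVec, ySum_apply]
  simp [Matrix.smul_mulVec]

theorem exists_constVec_add {n : ℕ} (v : Fin n → RingS k i) :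
    ∃ (α : Fin n → k) (β : Fin n → k) (c : Fin i → Fin n → RingS k i),
      v = constVec n α + xS k i • constVec n β + ySum k i _ c := by
  choose a b c h using fun l => exists_coordinates (v l)
  refine ⟨a, b, fun j l => c l j, ?_⟩
  funext l
  rw [h]
  simp [constVec, ySum_apply]

theorem map_mulVec_constVec {n : ℕ} (B : Matrix (Fin n) (Fin n) k) (β : Fin n → k) :
    (B.map (algebraMap k (RingS k i))).mulVec (constVec n β) = constVec n (B.mulVec β) := by
  funext a
  simp [constVec, Matrix.mulVec, dotProduct]

/-- Lifts of a basis of `M / (y)M` generate `M`, and the only relations needed are those expressing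
the action of `x` on these generators. -/
theorem exists_equiv_coker {M : Type u} [AddCommGroup M] [Module (RingS k i) M] [Module k M]
    [IsScalarTower k (RingS k i) M] [Module.Finite k M] (hM : YFree k i M)
    (hx : ∀ m : M, xS k i • m ∈ LinearMap.range (ySum k i M)) :
    ∃ (n : ℕ) (B : Fin i → Matrix (Fin n) (Fin n) k),
      Nonempty (M ≃ₗ[RingS k i] Coker (overS (linPlus B))) := by
  obtain ⟨σ, hσ⟩ := exists_section k i M
  have hinj := (sectionSum_bijective hσ hM).1
  let b := Module.finBasis k (M ⧸ yIm k i M)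
  set n := Module.finrank k (M ⧸ yIm k i M)
  choose m hm using hx
  -- Write `x σ(b_a) = ∑ y_j m_j`. Only the classes of the `m_j` modulo `(y)` matter, and the sign
  -- turns this into the relation in column `a`.
  let B : Fin i → Matrix (Fin n) (Fin n) k := fun j =>
    Matrix.of fun c a => - b.repr ((yIm k i M).mkQ (m (σ (b a)) j)) c
  let π : (Fin n → RingS k i) →ₗ[RingS k i] M :=
    Fintype.linearCombination (RingS k i) fun a => σ (b a)
  have hπ : ∀ α, π (constVec n α) = σ (∑ a, α a • b a) := fun α => by
    simp [π, constVec, Fintype.linearCombination_apply]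
  have hAπ : ∀ v, π ((overS (linPlus B)).mulVec v) = 0 := by
    intro v
    suffices h : π.comp (overS (linPlus B)).mulVecLin = 0 from LinearMap.congr_fun h v
    refine (Pi.basisFun _ _).ext fun a => ?_
    rw [LinearMap.comp_apply, Pi.basisFun_apply, Matrix.mulVecLin_apply, overS_linPlus_mulVec, map_add,
      map_smul, map_ySum, LinearMap.zero_apply]
    have h1 : π (Pi.single a 1) = σ (b a) := by
      simp [π, Fintype.linearCombination_apply_single]
    have h2 : ∀ j, π (((B j).map (algebraMap k (RingS k i))).mulVec (Pi.single a 1)) =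
        - σ ((yIm k i M).mkQ (m (σ (b a)) j)) := fun j => by
      have : ((B j).map (algebraMap k (RingS k i))).mulVec (Pi.single a 1) =
          constVec n fun c => B j c a := by
        funext c
        simp [constVec]
      rw [this, hπ]
      simp only [B, Matrix.of_apply, neg_smul, Finset.sum_neg_distrib, b.sum_repr, map_neg]
    simp only [h1, h2]
    rw [← hm, ← ySum_section hσ, ← map_add]
    exact (congrArg _ (funext fun j => add_neg_cancel _)).trans (map_zero _)
  have hsurj : Function.Surjective π := by
    -- Used twice: after a second substitution the error lies in `(y)² M = 0`.
    have hmk : ∀ t : M, ∃ v, ∃ w, t = π v + ySum k i M w := fun t => by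
      obtain ⟨w, hw⟩ := sub_section_mem hσ t
      refine ⟨constVec n (b.repr ((yIm k i M).mkQ t)), w, ?_⟩
      rw [hπ, b.sum_repr, hw, add_sub_cancel]
    intro t
    obtain ⟨v, w, rfl⟩ := hmk t
    choose v' w' h using fun j => hmk (w j)
    refine ⟨v + ySum k i _ v', ?_⟩
    rw [map_add, map_ySum, add_right_inj, eq_comm, ← sub_eq_zero, ← map_sub]
    refine ySum_eq_zero k i fun j => ⟨w' j, ?_⟩
    rw [Pi.sub_apply, h j, add_sub_cancel_left]
  have hker : LinearMap.ker π = LinearMap.range (overS (linPlus B)).mulVecLin := by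
    refine le_antisymm (fun v hv => ?_) ?_
    · obtain ⟨α, β, c, rfl⟩ := exists_constVec_add v
      choose γ δ d hc using fun j => exists_constVec_add (c j)
      -- `w` is the quotient in a division by `xI + ∑ B_j y_j`: it collects the coefficients of `x`
      -- in the vector. The remainder is free of `x`, and on such vectors `π` is injective by
      -- `sectionSum_bijective`.
      let w : Fin n → RingS k i := constVec n β + ySum k i (Fin n → RingS k i) fun j => constVec n (δ j)
      have hw : constVec n α + xS k i • constVec n β + ySum k i _ c =
          constVec n α + ySum k i (Fin n → RingS k i) (fun j => constVec n (γ j - (B j).mulVec β)) +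
            (overS (linPlus B)).mulVec w := by
        have hc' : ySum k i _ c = ySum k i (Fin n → RingS k i) (fun j => constVec n (γ j)) +
            xS k i • ySum k i (Fin n → RingS k i) fun j => constVec n (δ j) := by
          have hc₀ : c = (fun j => constVec (i := i) n (γ j)) +
              xS k i • (fun j => constVec (i := i) n (δ j)) + fun j => ySum k i _ (d j) := funext hc
          rw [hc₀, map_add, map_add, map_smul,
            ySum_eq_zero k i (m := fun j => ySum k i _ (d j)) fun j => ⟨_, rfl⟩, add_zero]
        have hB : (ySum k i _ fun j => ((B j).map (algebraMap k (RingS k i))).mulVec w) =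
            ySum k i (Fin n → RingS k i) fun j => constVec n ((B j).mulVec β) := by
          rw [← sub_eq_zero, ← map_sub]
          refine ySum_eq_zero k i fun j => ?_
          rw [Pi.sub_apply, Matrix.mulVec_add, map_mulVec_constVec, add_sub_cancel_left,
            ← Matrix.mulVecLin_apply, map_ySum]
          exact ⟨_, rfl⟩
        rw [overS_linPlus_mulVec, hB, hc', smul_add]
        simp only [map_sub]
        rw [show (fun j => constVec n (γ j) - constVec n ((B j).mulVec β)) =
          (fun j => constVec n (γ j) : Fin i → Fin n → RingS k i) -
            fun j => constVec n ((B j).mulVec β) from rfl, map_sub]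
        abel
      rw [hw] at hv ⊢
      have hv' : π (constVec n α) + ySum k i M (fun j => π (constVec n (γ j - (B j).mulVec β))) = 0 := by
        rw [← map_ySum, ← map_add]
        simpa [hAπ] using hv
      simp only [hπ] at hv'
      rw [← sectionSum_apply σ _ fun j => ∑ a, (γ j - (B j).mulVec β) a • b a] at hv'
      have h0 := hinj (hv'.trans (map_zero _).symm)
      have hz : ∀ f : Fin n → k, ∑ a, f a • b a = 0 → f = 0 := fun f hf =>
        funext (Fintype.linearIndependent_iff.1 b.linearIndependent f hf)
      have hα : α = 0 := hz _ (congrArg Prod.fst h0)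
      have hγ : ∀ j, γ j - (B j).mulVec β = 0 := fun j => hz _ (congrFun (congrArg Prod.snd h0) j)
      refine ⟨w, ?_⟩
      simp only [hα, hγ, map_zero, zero_add]
      rw [show (fun _ : Fin i => (0 : Fin n → RingS k i)) = 0 from rfl, map_zero, zero_add]
      rfl
    · rintro _ ⟨w, rfl⟩
      exact hAπ w
  exact ⟨n, B, ⟨((Submodule.quotEquivOfEq _ _ hker.symm).trans
    (π.quotKerEquivOfSurjective hsurj)).symm⟩⟩

/-- Induction on `dim_k M`: each copy of `S_i` split off lowers the dimension, and the complement, a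
retract, stays free over `k[y]/(y)²`. -/
theorem YFree.exists_equiv_prod_coker (d : ℕ) : ∀ (M : Type u) [AddCommGroup M]
    [Module (RingS k i) M] [Module k M] [IsScalarTower k (RingS k i) M] [Module.Finite k M],
    YFree k i M → Module.finrank k M = d →
    ∃ (r n : ℕ) (B : Fin i → Matrix (Fin n) (Fin n) k),
      Nonempty (M ≃ₗ[RingS k i] (Fin r → RingS k i) × Coker (overS (linPlus B))) := by
  induction d using Nat.strong_induction_on with
  | _ d ih =>
  intro M _ _ _ _ _ hM hd
  by_cases hx : ∀ m : M, xS k i • m ∈ LinearMap.range (ySum k i M)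
  · obtain ⟨n, B, ⟨e⟩⟩ := exists_equiv_coker hM hx
    exact ⟨0, n, B, ⟨e.trans (LinearEquiv.uniqueProd (M₂ := Fin 0 → RingS k i)).symm⟩⟩
  · push Not at hx
    obtain ⟨t, ht⟩ := hx
    obtain ⟨φ, hφ⟩ := exists_functional_of_xS_smul_notMem hM ht
    obtain ⟨e, he⟩ := exists_prod_equiv_of_functional φ hφ
    have hfin : Module.Finite k (LinearMap.ker φ) :=
      inferInstanceAs (Module.Finite k ((LinearMap.ker φ).restrictScalars k))
    have hlt : Module.finrank k (LinearMap.ker φ) < d := by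
      rw [← hd, ← (e.restrictScalars k).finrank_eq, Module.finrank_prod]
      have : 0 < Module.finrank k (RingS k i) := Module.finrank_pos
      omega
    obtain ⟨r, n, B, ⟨e'⟩⟩ := ih _ hlt (LinearMap.ker φ)
      (hM.of_retract (LinearMap.ker φ).subtype
        ((LinearMap.snd _ _ _).comp e.symm.toLinearMap) fun m => by
          have : e (0, m) = m := by simp [he]
          simp [← this]) rfl
    refine ⟨r + 1, n, B, ⟨e.symm.trans ((LinearEquiv.prodCongr (.refl _ _) e').trans
      ((LinearEquiv.prodAssoc _ _ _ _).symm.trans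
        (LinearEquiv.prodCongr (Fin.consLinearEquiv _ fun _ => RingS k i) (.refl _ _))))⟩⟩

end Structure

/-! ### Matrix factorizations of `x²` and their complete resolutions. -/

section MatrixFactorizations
variable {k : Type u} [Field k] {i n : ℕ}

theorem overS_mulVec (A : Matrix (Fin n) (Fin n) (RingQ k i)) (v : Fin n → RingQ k i) :
    (overS A).mulVec (fun a => QtoS k i (v a)) = fun a => QtoS k i (A.mulVec v a) :=
  funext fun a => (RingHom.map_mulVec (QtoS k i) A v a).symm

theorem IsMatrixFactorization.symm {R : Type*} [CommRing R] {f : R} {A A' : Matrix (Fin n) (Fin n) R}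
    (h : IsMatrixFactorization f A A') : IsMatrixFactorization f A' A := ⟨h.2, h.1⟩

theorem IsMatrixFactorization.transpose {R : Type*} [CommRing R] {f : R}
    {A A' : Matrix (Fin n) (Fin n) R} (h : IsMatrixFactorization f A A') :
    IsMatrixFactorization f A.transpose A'.transpose := by
  constructor
  · rw [← Matrix.transpose_mul, h.2, Matrix.transpose_smul, Matrix.transpose_one]
  · rw [← Matrix.transpose_mul, h.1, Matrix.transpose_smul, Matrix.transpose_one]

variable {A A' : Matrix (Fin n) (Fin n) (RingQ k i)}

/-- Lift a cycle to `V` over `Q_i`, so `A V = x² w`. Applying `A'` gives `x² V = x² A' w`, and `x²`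
cancels. -/
theorem IsMatrixFactorization.exact_overS (h : IsMatrixFactorization (xQ k i ^ 2) A A') :
    Function.Exact (overS A').mulVecLin (overS A).mulVecLin := by
  intro v
  choose V hV using fun a => QtoS_surjective k i (v a)
  obtain rfl : (fun a => QtoS k i (V a)) = v := funext hV
  constructor
  · intro hv
    rw [Matrix.mulVecLin_apply, overS_mulVec] at hv
    choose w hw using fun a => (QtoS_eq_zero_iff k i _).1 (congrFun hv a)
    have hw' : A.mulVec V = xQ k i ^ 2 • w := funext hw
    have h1 : xQ k i ^ 2 • V = xQ k i ^ 2 • A'.mulVec w := by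
      rw [← Matrix.mulVec_smul, ← hw', Matrix.mulVec_mulVec, h.2, Matrix.smul_mulVec,
        Matrix.one_mulVec]
    have h2 : V = A'.mulVec w := funext fun a => sub_eq_zero.1 <| xQ_sq_mul_cancel k i <| by
      rw [mul_sub, sub_eq_zero]
      exact congrFun h1 a
    refine ⟨fun a => QtoS k i (w a), ?_⟩
    rw [Matrix.mulVecLin_apply, overS_mulVec, h2]
  · rintro ⟨w, hw⟩
    choose W hW using fun a => QtoS_surjective k i (w a)
    obtain rfl : (fun a => QtoS k i (W a)) = w := funext hW
    rw [← hw, Matrix.mulVecLin_apply, Matrix.mulVecLin_apply, overS_mulVec, overS_mulVec,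
      Matrix.mulVec_mulVec, h.1, Matrix.smul_mulVec, Matrix.one_mulVec]
    exact funext fun a => (QtoS_eq_zero_iff k i _).2 ⟨W a, rfl⟩

/-- The dot product identifies `Rⁿ` with its dual and turns dual maps into transposes; transposes of
a matrix factorization form one again. -/
theorem exact_dualMap_of_exact_transpose {R : Type*} [CommRing R] {A A' : Matrix (Fin n) (Fin n) R}
    (h : Function.Exact A.transpose.mulVecLin A'.transpose.mulVecLin) :
    Function.Exact A.mulVecLin.dualMap A'.mulVecLin.dualMap := by
  have key : ∀ (C : Matrix (Fin n) (Fin n) R) (v : Fin n → R),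
      dotProductEquiv R (Fin n) (C.transpose.mulVecLin v) =
        C.mulVecLin.dualMap (dotProductEquiv R (Fin n) v) := by
    intro C v
    ext a
    simp [Matrix.vecMul, Matrix.col_def]
    rfl
  intro φ
  obtain ⟨v, rfl⟩ := (dotProductEquiv R (Fin n)).surjective φ
  rw [← key, LinearEquiv.map_eq_zero_iff, h v]
  constructor
  · rintro ⟨w, rfl⟩
    exact ⟨_, (key A w).symm⟩
  · rintro ⟨ψ, hψ⟩
    obtain ⟨w, rfl⟩ := (dotProductEquiv R (Fin n)).surjective ψ
    rw [← key] at hψ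
    exact ⟨w, (dotProductEquiv R (Fin n)).injective hψ⟩

theorem IsMatrixFactorization.exact_dual_overS (h : IsMatrixFactorization (xQ k i ^ 2) A A') :
    Function.Exact (overS A).mulVecLin.dualMap (overS A').mulVecLin.dualMap :=
  exact_dualMap_of_exact_transpose h.symm.transpose.exact_overS

theorem IsMatrixFactorization.isCompleteResolution
    (h : IsMatrixFactorization (xQ k i ^ 2) A A') {T : Type u} [AddCommGroup T]
    [Module (RingS k i) T] (e : Coker (overS A) ≃ₗ[RingS k i] T) :
    IsCompleteResolution (F := fun _ => Fin n → RingS k i) T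
      (alternating (overS A) (overS A')) where
  totallyAcyclic :=
    { free := fun _ => inferInstance
      finite := fun _ => inferInstance
      exact := fun m => by
        by_cases hm : Even m
        · have hm' : ¬ Even (m + 1) := by rwa [Int.even_add_one, not_not]
          simpa [alternating, hm, hm'] using h.exact_overS
        · have hm' : Even (m + 1) := by rwa [Int.even_add_one]
          simpa [alternating, hm, hm'] using h.symm.exact_overS
      exact_dual := fun m => by
        by_cases hm : Even m
        · have hm' : ¬ Even (m + 1) := by rwa [Int.even_add_one, not_not]
          simpa [alternating, hm, hm'] using h.exact_dual_overS
        · have hm' : Even (m + 1) := by rwa [Int.even_add_one]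
          simpa [alternating, hm, hm'] using h.symm.exact_dual_overS }
  syzygy := ⟨e⟩

theorem hasLeastPeriod_alternating {R : Type*} [CommRing R] (A A' : Matrix (Fin n) (Fin n) R) :
    HasLeastPeriod (alternating A A') 1 ∨ HasLeastPeriod (alternating A A') 2 := by
  by_cases h : Function.Periodic (alternating A A') ((1 : ℕ) : ℤ)
  · exact Or.inl ⟨⟨one_pos, h⟩, fun q hq => hq.1⟩
  · refine Or.inr ⟨⟨two_pos, fun m => ?_⟩, fun q hq => ?_⟩
    · simp [alternating]
    · by_contra hlt
      obtain rfl : q = 1 := by have := hq.1; omega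
      exact h hq.2

theorem sum_yQ_smul_mul_sum_yQ_smul (C D : Fin i → Matrix (Fin n) (Fin n) (RingQ k i)) :
    (∑ j, yQ k i j • C j) * ∑ j, yQ k i j • D j = 0 := by
  simp [Finset.sum_mul_sum, smul_smul, yQ_mul_yQ]

theorem isMatrixFactorization_linPlus_linMinus (B : Fin i → Matrix (Fin n) (Fin n) k) :
    IsMatrixFactorization (xQ k i ^ 2) (linPlus B) (linMinus B) := by
  have h := sum_yQ_smul_mul_sum_yQ_smul (fun j => (B j).map (algebraMap k (RingQ k i)))
    fun j => (B j).map (algebraMap k (RingQ k i))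
  unfold IsMatrixFactorization linPlus linMinus
  constructor
  · rw [add_mul, mul_sub, mul_sub, h]
    simp [smul_smul, pow_two]
  · rw [sub_mul, mul_add, mul_add, h]
    simp [smul_smul, pow_two]

theorem linMinus_eq_linPlus_neg (B : Fin i → Matrix (Fin n) (Fin n) k) :
    linMinus B = linPlus (-B) := by
  ext a b
  simp [linMinus, linPlus, Matrix.sum_apply, sub_eq_add_neg]

theorem xS_mem_maxIdealS : xS k i ∈ maxIdealS k i := Ideal.subset_span ⟨none, rfl⟩

theorem yS_mem_maxIdealS (j : Fin i) : yS k i j ∈ maxIdealS k i := Ideal.subset_span ⟨some j, rfl⟩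

theorem range_overS_linPlus_le (B : Fin i → Matrix (Fin n) (Fin n) k) :
    LinearMap.range (overS (linPlus B)).mulVecLin ≤
      maxIdealS k i • (⊤ : Submodule (RingS k i) (Fin n → RingS k i)) := by
  rintro _ ⟨v, rfl⟩
  rw [Matrix.mulVecLin_apply, overS_linPlus_mulVec, ySum_apply]
  exact add_mem (Submodule.smul_mem_smul xS_mem_maxIdealS trivial)
    (sum_mem fun j _ => Submodule.smul_mem_smul (yS_mem_maxIdealS j) trivial)

theorem isMinimalComplex_linPlus_linMinus (B : Fin i → Matrix (Fin n) (Fin n) k) :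
    IsMinimalComplex (F := fun _ => Fin n → RingS k i) (maxIdealS k i)
      (alternating (overS (linPlus B)) (overS (linMinus B))) := by
  intro m
  unfold alternating
  split_ifs
  · exact range_overS_linPlus_le B
  · rw [linMinus_eq_linPlus_neg]
    exact range_overS_linPlus_le (-B)

instance : RingHomSurjective (augS k i) := ⟨fun c => ⟨algebraMap k _ c, augS_algebraMap c⟩⟩

variable (k i) in
/-- The augmentation applied to each entry of a vector. -/
noncomputable def augVec (n : ℕ) : (Fin n → RingS k i) →ₛₗ[augS k i] (Fin n → k) where
  toFun v a := augS k i (v a)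
  map_add' v w := by ext; simp
  map_smul' s v := by ext; simp

/-- The upper bound comes from the surjection from `S_iⁿ`. For the lower bound, entries in the
kernel of the augmentation let the cokernel map onto `kⁿ`. -/
theorem spanFinrank_coker {A : Matrix (Fin n) (Fin n) (RingS k i)}
    (hA : ∀ a b, augS k i (A a b) = 0) :
    (⊤ : Submodule (RingS k i) (Coker A)).spanFinrank = n := by
  apply le_antisymm
  · have := Submodule.spanFinrank_map_le_of_fg (LinearMap.range A.mulVecLin).mkQ
      (p := ⊤) Module.Finite.fg_top
    rwa [Submodule.map_top, Submodule.range_mkQ,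
      ← Module.finrank_eq_spanFinrank_of_free (M := Fin n → RingS k i),
      Module.finrank_fin_fun] at this
  · let f : Coker A →ₛₗ[augS k i] (Fin n → k) := (LinearMap.range A.mulVecLin).liftQ (augVec k i n) (by
      rintro _ ⟨v, rfl⟩
      ext a
      simp [augVec, Matrix.mulVec, dotProduct, hA])
    have hf : Function.Surjective f := fun c => by
      refine ⟨Submodule.Quotient.mk (fun a => algebraMap k _ (c a)), ?_⟩
      ext a
      exact augS_algebraMap _
    have := Submodule.spanFinrank_map_le_of_fg f (p := ⊤) Module.Finite.fg_top
    rwa [Submodule.map_top, LinearMap.range_eq_top.2 hf, ← Module.finrank_eq_spanFinrank_of_free,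
      Module.finrank_fin_fun] at this

theorem spanFinrank_top_eq_of_equiv {R M N : Type*} [Ring R] [AddCommGroup M] [Module R M]
    [AddCommGroup N] [Module R N] (e : M ≃ₗ[R] N) :
    (⊤ : Submodule R M).spanFinrank = (⊤ : Submodule R N).spanFinrank := by
  rw [← Submodule.spanFinrank_map_eq_of_injective e.toLinearMap e.injective, Submodule.map_top,
    LinearEquiv.range]

/-- The block diagonal matrix with blocks `A` and `c I_r`. -/
noncomputable def addScalar {R : Type*} [CommRing R] (A : Matrix (Fin n) (Fin n) R) (r : ℕ) (c : R) :
    Matrix (Fin (n + r)) (Fin (n + r)) R :=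
  Matrix.reindexAlgEquiv R R finSumFinEquiv (Matrix.fromBlocks A 0 0 (c • 1))

/-- For `c = x²` the added block of the first matrix vanishes over `S_i`, so its cokernel gains a
free summand of rank `r`. -/
theorem IsMatrixFactorization.addScalar {R : Type*} [CommRing R] {c : R}
    {A A' : Matrix (Fin n) (Fin n) R} (h : IsMatrixFactorization c A A') (r : ℕ) :
    IsMatrixFactorization c (addScalar A r c) (addScalar A' r 1) := by
  unfold TotRefl.addScalar IsMatrixFactorization
  rw [← map_mul, ← map_mul, Matrix.fromBlocks_multiply, Matrix.fromBlocks_multiply, h.1, h.2,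
    ← map_one (Matrix.reindexAlgEquiv R R finSumFinEquiv), ← map_smul, ← Matrix.fromBlocks_one,
    Matrix.fromBlocks_smul]
  simp

theorem overS_addScalar_mulVec (A : Matrix (Fin n) (Fin n) (RingQ k i)) (r : ℕ)
    (v : Fin (n + r) → RingS k i) :
    (overS (addScalar A r (xQ k i ^ 2))).mulVec v =
      Fin.append ((overS A).mulVec fun a => v (Fin.castAdd r a)) 0 := by
  have h : overS (addScalar A r (xQ k i ^ 2)) = Matrix.reindex finSumFinEquiv finSumFinEquiv
      (Matrix.fromBlocks (overS A) 0 0 (0 : Matrix (Fin r) (Fin r) (RingS k i))) := by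
    have : ((xQ k i ^ 2) • (1 : Matrix (Fin r) (Fin r) (RingQ k i))).map (QtoS k i) = 0 := by
      ext a b
      simp [(QtoS_eq_zero_iff k i _).2]
    change Matrix.reindex finSumFinEquiv finSumFinEquiv ((Matrix.fromBlocks A 0 0
      ((xQ k i ^ 2) • (1 : Matrix (Fin r) (Fin r) (RingQ k i)))).map (QtoS k i)) = _
    rw [Matrix.fromBlocks_map, this]
    simp [overS]
  rw [h, Matrix.reindex_apply, Matrix.submatrix_mulVec_equiv, Matrix.fromBlocks_mulVec]
  funext a
  induction a using Fin.addCases <;> simp [Function.comp_def]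

theorem exists_coker_addScalar_equiv (A : Matrix (Fin n) (Fin n) (RingQ k i)) (r : ℕ) :
    Nonempty (Coker (overS (addScalar A r (xQ k i ^ 2))) ≃ₗ[RingS k i]
      (Fin r → RingS k i) × Coker (overS A)) := by
  let π : (Fin (n + r) → RingS k i) →ₗ[RingS k i] (Fin r → RingS k i) × Coker (overS A) :=
    (LinearMap.funLeft _ _ (Fin.natAdd n)).prod
      ((Submodule.mkQ _).comp (LinearMap.funLeft _ _ (Fin.castAdd r)))
  have hπ : ∀ v, π v = (fun a => v (Fin.natAdd n a),
      Submodule.Quotient.mk fun a => v (Fin.castAdd r a)) := fun _ => rfl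
  have hsurj : Function.Surjective π := by
    rintro ⟨w, q⟩
    obtain ⟨u, rfl⟩ := Submodule.Quotient.mk_surjective _ q
    refine ⟨Fin.append u w, ?_⟩
    rw [hπ]
    simp
  have hker : LinearMap.ker π = LinearMap.range (overS (addScalar A r (xQ k i ^ 2))).mulVecLin := by
    ext v
    rw [LinearMap.mem_ker, hπ, Prod.mk_eq_zero, Submodule.Quotient.mk_eq_zero]
    constructor
    · rintro ⟨h0, w, hw⟩
      refine ⟨Fin.append w 0, ?_⟩
      rw [Matrix.mulVecLin_apply] at hw ⊢
      rw [overS_addScalar_mulVec]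
      simp only [Fin.append_left, hw]
      funext a
      induction a using Fin.addCases with
      | left a => simp
      | right a => simpa using (congrFun h0 a).symm
    · rintro ⟨w, rfl⟩
      rw [Matrix.mulVecLin_apply, overS_addScalar_mulVec]
      refine ⟨by funext a; simp, ⟨fun a => w (Fin.castAdd r a), ?_⟩⟩
      simp
  exact ⟨(Submodule.quotEquivOfEq _ _ hker.symm).trans (π.quotKerEquivOfSurjective hsurj)⟩

theorem augS_overS_linPlus (B : Fin i → Matrix (Fin n) (Fin n) k) (a b : Fin n) :
    augS k i (overS (linPlus B) a b) = 0 := by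
  simp [overS, linPlus, Matrix.sum_apply]

theorem augS_overS_addScalar {A : Matrix (Fin n) (Fin n) (RingQ k i)}
    (hA : ∀ a b, augS k i (overS A a b) = 0) (r : ℕ) (a b : Fin (n + r)) :
    augS k i (overS (addScalar A r (xQ k i ^ 2)) a b) = 0 := by
  have := congrFun (overS_addScalar_mulVec A r (Pi.single b 1)) a
  rw [Matrix.mulVec_single_one] at this
  change overS (addScalar A r (xQ k i ^ 2)) a b = _ at this
  rw [this]
  induction a using Fin.addCases with
  | left a => simp [Matrix.mulVec, dotProduct, hA]
  | right a => simp

theorem eq_zero_of_hasNoProjectiveSummand {R : Type u} [CommRing R] [Nontrivial R] {T C : Type u}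
    [AddCommGroup T] [Module R T] [AddCommGroup C] [Module R C] {r : ℕ}
    (h : HasNoProjectiveSummand R T) (e : T ≃ₗ[R] (Fin r → R) × C) : r = 0 := by
  let f : (Fin r → R) →ₗ[R] T := e.symm.toLinearMap.comp (LinearMap.inl R _ _)
  have hf : Function.Injective f := e.symm.injective.comp LinearMap.inl_injective
  have hc : IsCompl (LinearMap.range f)
      (LinearMap.range (e.symm.toLinearMap.comp (LinearMap.inr R (Fin r → R) C))) := by
    rw [LinearMap.range_comp, LinearMap.range_comp]
    exact (Submodule.orderIsoMapComap e.symm).isCompl LinearMap.isCompl_range_inl_inr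
  have hbot := h _ _ hc (Module.Projective.of_equiv (LinearEquiv.ofInjective f hf))
  rw [LinearMap.range_eq_bot] at hbot
  by_contra hr
  have : f (fun _ => 1) = f 0 := by rw [hbot]; rfl
  exact one_ne_zero (congrFun (hf this) ⟨0, Nat.pos_of_ne_zero hr⟩)

end MatrixFactorizations
end TotRefl
-- Assembly of the three statements.
theorem corollary3p5 {k : Type u} [Field k] [CharZero k] {i : ℕ} (hi : 2 ≤ i)
    (T : Type u) [AddCommGroup T] [Module (TotRefl.RingS k i) T]
    (hT : TotRefl.IsTotallyReflexive (TotRefl.RingS k i) T)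
    (n : ℕ) (hn : n = (⊤ : Submodule (TotRefl.RingS k i) T).spanFinrank) :
    -- a periodic complete resolution coming from a matrix factorization of x² over Q_i
    (∃ A A' : Matrix (Fin n) (Fin n) (TotRefl.RingQ k i),
      TotRefl.IsMatrixFactorization (TotRefl.xQ k i ^ 2) A A' ∧
      TotRefl.IsCompleteResolution (F := fun _ => Fin n → TotRefl.RingS k i) T
        (TotRefl.alternating (TotRefl.overS A) (TotRefl.overS A')) ∧
      (TotRefl.HasLeastPeriod (TotRefl.alternating (TotRefl.overS A) (TotRefl.overS A')) 1 ∨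
        TotRefl.HasLeastPeriod (TotRefl.alternating (TotRefl.overS A) (TotRefl.overS A')) 2)) ∧
    -- without projective summands, T is the cokernel of some x I_n + ∑ B_j y_j
    (TotRefl.HasNoProjectiveSummand (TotRefl.RingS k i) T →
      ∃ B : Fin i → Matrix (Fin n) (Fin n) k,
        Nonempty (TotRefl.Coker (TotRefl.overS (TotRefl.linPlus B)) ≃ₗ[TotRefl.RingS k i] T)) ∧
    -- every such matrix gives a minimal periodic complete resolution of the stated form
    (∀ B : Fin i → Matrix (Fin n) (Fin n) k,
      Nonempty (TotRefl.Coker (TotRefl.overS (TotRefl.linPlus B)) ≃ₗ[TotRefl.RingS k i] T) →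
      TotRefl.IsMatrixFactorization (TotRefl.xQ k i ^ 2)
        (TotRefl.linPlus B) (TotRefl.linMinus B) ∧
      TotRefl.IsCompleteResolution (F := fun _ => Fin n → TotRefl.RingS k i) T
        (TotRefl.alternating (TotRefl.overS (TotRefl.linPlus B))
          (TotRefl.overS (TotRefl.linMinus B))) ∧
      TotRefl.IsMinimalComplex (F := fun _ => Fin n → TotRefl.RingS k i) (TotRefl.maxIdealS k i)
        (TotRefl.alternating (TotRefl.overS (TotRefl.linPlus B))
          (TotRefl.overS (TotRefl.linMinus B))) ∧
      (TotRefl.HasLeastPeriod (TotRefl.alternating (TotRefl.overS (TotRefl.linPlus B))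
          (TotRefl.overS (TotRefl.linMinus B))) 1 ∨
        TotRefl.HasLeastPeriod (TotRefl.alternating (TotRefl.overS (TotRefl.linPlus B))
          (TotRefl.overS (TotRefl.linMinus B))) 2)) := by
  let : Module k T := Module.compHom T (algebraMap k (TotRefl.RingS k i))
  have : IsScalarTower k (TotRefl.RingS k i) T := IsScalarTower.of_algebraMap_smul fun _ _ => rfl
  have := hT.finite
  have : Module.Finite k T := Module.Finite.trans (TotRefl.RingS k i) T
  obtain ⟨r, m, B, ⟨e⟩⟩ := TotRefl.YFree.exists_equiv_prod_coker _ T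
    (TotRefl.yFree_of_subsingleton_ext_two hi (hT.ext_eq_zero 2 two_pos)) rfl
  obtain ⟨e'⟩ := TotRefl.exists_coker_addScalar_equiv (TotRefl.linPlus B) r
  -- All entries of the padded matrix lie in the kernel of the augmentation, so its size is the
  -- minimal number of generators of `T`.
  obtain rfl : n = m + r := by
    rw [hn, ← TotRefl.spanFinrank_top_eq_of_equiv (e'.trans e.symm)]
    exact TotRefl.spanFinrank_coker
      (TotRefl.augS_overS_addScalar (TotRefl.augS_overS_linPlus B) r)
  refine ⟨?_, fun h => ?_, ?_⟩
  · have hmf := (TotRefl.isMatrixFactorization_linPlus_linMinus B).addScalar r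
    exact ⟨_, _, hmf, hmf.isCompleteResolution (e'.trans e.symm),
      TotRefl.hasLeastPeriod_alternating _ _⟩
  · obtain rfl := TotRefl.eq_zero_of_hasNoProjectiveSummand h e
    exact ⟨B, ⟨(e.trans LinearEquiv.uniqueProd).symm⟩⟩
  · rintro B ⟨e⟩
    have hmf := TotRefl.isMatrixFactorization_linPlus_linMinus B
    exact ⟨hmf, hmf.isCompleteResolution e, TotRefl.isMinimalComplex_linPlus_linMinus B,
      TotRefl.hasLeastPeriod_alternating _ _⟩
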